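/- Let $\mathcal G=(\mathcal N,\mathcal E)$ be a connected undirected graph on the finite set $\mathcal N$ of agents, with neighbor sets $\mathcal N_i$ and degrees $d_i=|\mathcal N_i|$. For every $i\in\mathcal N$ let $f_i:\mathbb R^{n_i}\to\mathbb R\cup\{+\infty\}$ be convex, closed and proper, let $A_i:\mathbb R^{n_i}\to\mathbb R^m$ be linear and $b_i\in\mathbb R^m$, and let $\mathcal K\subseteq\mathbb R^m$ be a nonempty closed convex cone with polar cone $\mathcal K^\circ=\{y \mid \langle x,y\rangle\le 0\ \forall x\in\mathcal K\}$. All the spaces carry an inner product $\langle\cdot,\cdot\rangle$ with the induced norm. Consider the primal problem $$(\mathcal P)\qquad \text{minimize}\ \sum_{i\in\mathcal N} f_i(x_i)\quad\text{subject to}\quad \sum_{i\in\mathcal N}(A_ix_i-b_i)\in\mathcal K,$$ and its dual $$(\mathcal D)\qquad \text{maximize}_y\ -\sum_{i\in\mathcal N}\big(f_i^*(-A_i^*y)+\langle y,b_i\rangle+\mathcal I_{\mathcal K^\circ}(y)\big),$$ where $f_i^*(u)=\sup_x\{\langle u,x\rangle-f_i(x)\}$ is the conjugate of $f_i$, $A_i^*$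 the adjoint of $A_i$, and $\mathcal I_{\mathcal K^\circ}$ equals $0$ on $\mathcal K^\circ$ and $+\infty$ elsewhere. Assume that $(\mathcal P)$ has a minimizer, $(\mathcal D)$ has a maximizer, and the optimal values are equal. Let $\sigma,\rho>0$, let $y_i^0,z_i^0,s_i^0\in\mathbb R^m$ be arbitrary and $p_i^0=0$, and let the sequences satisfy, for all $i\in\mathcal N$ and $k\ge 0$ (decomposed dual consensus ADMM), $$\begin{aligned} p_i^{k+1}&=p_i^k+\rho\sum_{j\in\mathcal N_i}(y_i^k-y_j^k),\qquad s_i^{k+1}=s_i^k+\sigma(y_i^k-z_i^k),\\ r_i^{k+1}&=\sigma z_i^k+\rho\sum_{j\in\mathcal N_i}(y_i^k+y_j^k)-(b_i+p_i^{k+1}+s_i^{k+1}),\\ x_i^{k+1}&\in\operatorname*{argmin}_{x_i}\Big\{f_i(x_i)+\tfrac{1}{2(\sigma+2\rho d_i)}\|A_ix_i+r_i^{k+1}\|^2\Big\},\\ y_i^{k+1}&=\tfrac{1}{\sigma+2\rho d_i}\big(A_ix_i^{k+1}+r_i^{k+1}\big),\qquad z_i^{k+1}=\Pi_{\mathcal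 K^\circ}\big(y_i^{k+1}+\tfrac1\sigma s_i^{k+1}\big), \end{aligned}$$ where $\Pi_{\mathcal K^\circ}$ is the projection onto $\mathcal K^\circ$. Then there is a maximizer $y^\star$ of $(\mathcal D)$ such that $y_i^k\to y^\star$ and $z_i^k\to y^\star$ as $k\to\infty$ for every $i\in\mathcal N$. Moreover, every limit point of the sequence $\big((x_i^k)_{i\in\mathcal N}\big)_k$ is a minimizer of $(\mathcal P)$. -/

import Mathlib

open Filter Topology

namespace DualConsensus

noncomputable section

/-- A function `f : E → EReal` is proper if it never takes the value `-∞` and is finite somewhere.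
(In particular it takes its values in `ℝ ∪ {+∞}`.) -/
def ProperFun {E : Type*} (f : E → EReal) : Prop :=
  (∀ x, f x ≠ ⊥) ∧ ∃ x, f x ≠ ⊤

/-- An extended-real-valued function is convex if its epigraph is convex. -/
def ConvexFun {E : Type*} [NormedAddCommGroup E] [InnerProductSpace ℝ E] (f : E → EReal) : Prop :=
  Convex ℝ {q : E × ℝ | f q.1 ≤ (q.2 : EReal)}

/-- The conjugate `f^*(u) = sup_x (⟪u, x⟫ - f x)`. -/
def conjugate {E : Type*} [NormedAddCommGroup E] [InnerProductSpace ℝ E]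
    (f : E → EReal) (u : E) : EReal :=
  ⨆ x, ((inner ℝ u x : ℝ) : EReal) - f x

open Classical in
/-- The indicator function of a set: `0` on the set and `+∞` outside. -/
def indicatorFun {E : Type*} (C : Set E) (x : E) : EReal :=
  if x ∈ C then 0 else ⊤

/-- The polar cone `{y | ∀ x ∈ K, ⟪x, y⟫ ≤ 0}`. -/
def polarCone {F : Type*} [NormedAddCommGroup F] [InnerProductSpace ℝ F] (K : Set F) : Set F :=
  {y | ∀ x ∈ K, inner ℝ x y ≤ 0}

/-- `z` is a projection of `v` onto `C`: a point of `C` at minimal distance from `v`. -/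
def IsProjection {F : Type*} [NormedAddCommGroup F] (C : Set F) (v z : F) : Prop :=
  z ∈ C ∧ IsMinOn (fun w => ‖v - w‖) C z

/-- The data of the resource allocation problem
`minimize ∑ i, f i (x i)` subject to `∑ i, (A i (x i) - b i) ∈ K`. -/
structure Problem (ι : Type*) (E : ι → Type*) (F : Type*)
    [∀ i, NormedAddCommGroup (E i)] [∀ i, InnerProductSpace ℝ (E i)]
    [NormedAddCommGroup F] [InnerProductSpace ℝ F] where
  /-- local objective functions -/
  f : ∀ i, E i → EReal
  /-- local constraint operators -/
  A : ∀ i, E i →ₗ[ℝ] F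
  /-- local constraint vectors -/
  b : ι → F
  /-- the cone of the coupling constraint -/
  K : ConvexCone ℝ F

namespace Problem

variable {ι : Type*} [Fintype ι] {E : ι → Type*} {F : Type*}
  [∀ i, NormedAddCommGroup (E i)] [∀ i, InnerProductSpace ℝ (E i)]
  [∀ i, FiniteDimensional ℝ (E i)]
  [NormedAddCommGroup F] [InnerProductSpace ℝ F] [FiniteDimensional ℝ F]

/-- The feasible set of the primal problem. -/
def feasible (P : Problem ι E F) : Set (∀ i, E i) :=
  {x | ∑ i, (P.A i (x i) - P.b i) ∈ P.K}

/-- The primal objective. -/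
def primalObj (P : Problem ι E F) (x : ∀ i, E i) : EReal :=
  ∑ i, P.f i (x i)

/-- `x` is a minimizer of the primal problem. -/
def IsPrimalMinimizer (P : Problem ι E F) (x : ∀ i, E i) : Prop :=
  x ∈ P.feasible ∧ IsMinOn P.primalObj P.feasible x

/-- The dual objective `-∑ i, (f_i^*(-A_i^* y) + ⟪y, b_i⟫ + I_{K°}(y))`. -/
def dualObj (P : Problem ι E F) (y : F) : EReal :=
  -∑ i, (conjugate (P.f i) (-(LinearMap.adjoint (P.A i) y)) + ((inner ℝ y (P.b i) : ℝ) : EReal)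
    + indicatorFun (polarCone (P.K : Set F)) y)

/-- `y` is a maximizer of the dual problem. -/
def IsDualMaximizer (P : Problem ι E F) (y : F) : Prop :=
  IsMaxOn P.dualObj Set.univ y

/-- The standing assumptions on the problem data: the `f i` are convex, closed and proper, `K` is
nonempty and closed (it is a convex cone by its type), a primal-dual solution exists and the
duality gap is zero. -/
structure Assumptions (P : Problem ι E F) : Prop where
  convex : ∀ i, ConvexFun (P.f i)
  closed : ∀ i, LowerSemicontinuous (P.f i)
  proper : ∀ i, ProperFun (P.f i)
  cone_nonempty : (P.K : Set F).Nonempty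
  cone_closed : IsClosed (P.K : Set F)
  exists_solution : ∃ x y, P.IsPrimalMinimizer x ∧ P.IsDualMaximizer y ∧ P.primalObj x = P.dualObj y

/-- The sequences are generated by the decomposed dual consensus ADMM on the graph `G` with
parameters `σ` and `ρ`. The initial values `y 0`, `z 0`, `s 0` are arbitrary and `p 0 = 0`; the
values `r 0` and `x 0` are not used. The `x`-update may pick any minimizer. -/
structure IsRun (P : Problem ι E F) (G : SimpleGraph ι) [DecidableRel G.Adj] (σ ρ : ℝ)
    (p s r : ℕ → ι → F) (x : ℕ → ∀ i, E i) (y z : ℕ → ι → F) : Prop where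
  p_zero : ∀ i, p 0 i = 0
  p_succ : ∀ k i, p (k + 1) i = p k i + ρ • ∑ j ∈ G.neighborFinset i, (y k i - y k j)
  s_succ : ∀ k i, s (k + 1) i = s k i + σ • (y k i - z k i)
  r_succ : ∀ k i, r (k + 1) i =
    σ • z k i + ρ • ∑ j ∈ G.neighborFinset i, (y k i + y k j)
      - (P.b i + p (k + 1) i + s (k + 1) i)
  x_succ : ∀ k i,
    IsMinOn
      (fun u : E i => P.f i u +
        ((1 / (2 * (σ + 2 * ρ * (G.degree i : ℝ))) * ‖P.A i u + r (k + 1) i‖ ^ 2 : ℝ) : EReal))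
      Set.univ (x (k + 1) i)
  y_succ : ∀ k i, y (k + 1) i =
    (1 / (σ + 2 * ρ * (G.degree i : ℝ))) • (P.A i (x (k + 1) i) + r (k + 1) i)
  z_succ : ∀ k i,
    IsProjection (polarCone (P.K : Set F)) (y (k + 1) i + (1 / σ) • s (k + 1) i) (z (k + 1) i)

end Problem

end

end DualConsensus

namespace DualConsensus

/-! Stack the agents' variables. Up to sign, the dual is to minimize `∑ i, (g i (y i) + I_{K°}(z
i))` with `g i y = f_i^*(-A_i^* y) + ⟪y, b_i⟫`, subject to `y = z` and `B y = 0`, where `B` takes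
scaled differences along edges. The iteration is ADMM for this splitting with the proximal term `‖C
(y - y^k)‖² / 2`, `C` taking scaled sums along edges. As `B^* B + C^* C` is `2ρ` times the degree
matrix, the `y`-step decouples.

The pairs (`W = b - A x`, `y`) and (`S`, `z`) are monotone, since `W` is a subgradient of `g` and
`S` is normal to the polar cone, and `W = -S - B^* D` up to increments of `z` and `y`. Hence a
Lyapunov function decreases relative to any solution (`lyapunov_descent`). A cluster point can
itself serve as reference point, so the whole sequence converges (`exists_tendsto_of_monotone`).

The first reference point comes from the KKT conditions (`exists_kkt`): by connectedness `B^*`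
reaches every family with sum zero. In the limit `A_i x_i` converges even if `x_i` does not. Summing
over agents removes `B^* d`, which leaves the optimality conditions of both problems. -/

theorem inner_sub_sub_eq {V : Type*} [NormedAddCommGroup V] [InnerProductSpace ℝ V] (a b c : V) :
    2 * inner ℝ (a - b) (a - c) = ‖a - c‖ ^ 2 - ‖b - c‖ ^ 2 + ‖a - b‖ ^ 2 := by
  have h : b - c = (a - c) - (a - b) := by abel
  rw [h, norm_sub_sq_real (a - c), real_inner_comm]
  ring

theorem tendsto_zero_of_sq_le {V : Type*} [NormedAddCommGroup V] {u : ℕ → V} {g : ℕ → ℝ} {c : ℝ}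
    (hg : Tendsto g atTop (𝓝 0)) (h : ∀ n, ‖u n‖ ^ 2 ≤ c * g n) : Tendsto u atTop (𝓝 0) := by
  rw [tendsto_zero_iff_norm_tendsto_zero]
  have h0 : Tendsto (fun n => ‖u n‖ ^ 2) atTop (𝓝 0) :=
    squeeze_zero (fun n => sq_nonneg _) h (by simpa using hg.const_mul c)
  have := h0.sqrt
  simpa [Real.sqrt_sq] using this

/-! ### Abstract convergence by a Lyapunov function -/

section Lyapunov

variable {H H₁ H₂ : Type*} [NormedAddCommGroup H] [InnerProductSpace ℝ H]
  [NormedAddCommGroup H₁] [NormedAddCommGroup H₂] [InnerProductSpace ℝ H₂]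

/-- The Lyapunov function of the iteration, relative to a reference point `(y, s, d)`. -/
noncomputable def lyapunov (C : H →ₗ[ℝ] H₂) (σ : ℝ) (Y Z S : ℕ → H) (D : ℕ → H₁)
    (y s : H) (d : H₁) (n : ℕ) : ℝ :=
  ‖S n - s‖ ^ 2 / σ + ‖D n - d‖ ^ 2 + σ * ‖Z n - y‖ ^ 2 + ‖C (Y n - y)‖ ^ 2

/-- No bound on `Y` is extracted, because `C` may have a kernel; `Y` is recovered later from `Y - Z
→ 0`. -/
theorem lyapunov_bounds (C : H →ₗ[ℝ] H₂) {σ : ℝ} (hσ : 0 < σ) (Y Z S : ℕ → H) (D : ℕ → H₁)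
    (y s : H) (d : H₁) (n : ℕ) :
    ‖S n - s‖ ^ 2 ≤ σ * lyapunov C σ Y Z S D y s d n ∧
    ‖D n - d‖ ^ 2 ≤ 1 * lyapunov C σ Y Z S D y s d n ∧
    ‖Z n - y‖ ^ 2 ≤ σ⁻¹ * lyapunov C σ Y Z S D y s d n := by
  have h1 : 0 ≤ ‖S n - s‖ ^ 2 / σ := by positivity
  have h2 : 0 ≤ ‖D n - d‖ ^ 2 := by positivity
  have h3 : 0 ≤ σ * ‖Z n - y‖ ^ 2 := by positivity
  have h4 : 0 ≤ ‖C (Y n - y)‖ ^ 2 := by positivity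
  unfold lyapunov
  refine ⟨?_, by linarith, ?_⟩
  · rw [← div_le_iff₀' hσ]; linarith
  · rw [← div_eq_inv_mul, le_div_iff₀' hσ]; linarith

variable [InnerProductSpace ℝ H₁]
  [FiniteDimensional ℝ H] [FiniteDimensional ℝ H₁] [FiniteDimensional ℝ H₂]

/-- Add the two monotonicity inequalities against the reference point to the one between consecutive
`(S, Z)`, which gives the cross term of the increments of `S` and `Z` its sign. The three-point
identity `inner_sub_sub_eq` turns each remaining product into a difference of squares. -/
theorem lyapunov_descent (B : H →ₗ[ℝ] H₁) (C : H →ₗ[ℝ] H₂) {σ : ℝ} (hσ : 0 < σ)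
    {Y Z S W : ℕ → H} {D : ℕ → H₁}
    (hD : ∀ n, D (n + 1) = D n + B (Y (n + 1)))
    (hS : ∀ n, S (n + 1) = S n + σ • (Y (n + 1) - Z (n + 1)))
    (hW : ∀ n, W (n + 1) = -S (n + 1) - LinearMap.adjoint B (D (n + 1))
      - σ • (Z (n + 1) - Z n) - LinearMap.adjoint C (C (Y (n + 1) - Y n)))
    (monoS : ∀ m n, 0 ≤ inner ℝ (S m - S n) (Z m - Z n))
    {y s : H} {d : H₁} (hy : B y = 0)
    (starW : ∀ n, 0 ≤ inner ℝ (W n - (-s - LinearMap.adjoint B d)) (Y n - y))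
    (starS : ∀ n, 0 ≤ inner ℝ (S n - s) (Z n - y)) (n : ℕ) :
    lyapunov C σ Y Z S D y s d (n + 1) + (‖S (n + 1) - S n‖ ^ 2 / σ + ‖D (n + 1) - D n‖ ^ 2
      + σ * ‖Z (n + 1) - Z n‖ ^ 2 + ‖C (Y (n + 1)) - C (Y n)‖ ^ 2)
      ≤ lyapunov C σ Y Z S D y s d n := by
  have h1 := starW (n + 1)
  have h2 := starS (n + 1)
  have h3 := monoS (n + 1) n
  have eS := inner_sub_sub_eq (S (n + 1)) (S n) s
  have eD := inner_sub_sub_eq (D (n + 1)) (D n) d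
  have eZ := inner_sub_sub_eq (Z (n + 1)) (Z n) y
  have eC := inner_sub_sub_eq (C (Y (n + 1))) (C (Y n)) (C y)
  have hYZ : Y (n + 1) - y = (Z (n + 1) - y) + σ⁻¹ • (S (n + 1) - S n) := by
    rw [hS n, add_sub_cancel_left, smul_smul, inv_mul_cancel₀ hσ.ne', one_smul]; abel
  have hBY : B (Y (n + 1) - y) = D (n + 1) - D n := by
    rw [hD n, map_sub, hy]; abel
  have key : W (n + 1) - (-s - LinearMap.adjoint B d) = -(S (n + 1) - s)
      - LinearMap.adjoint B (D (n + 1) - d) - σ • (Z (n + 1) - Z n)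
      - LinearMap.adjoint C (C (Y (n + 1) - Y n)) := by
    rw [hW n, map_sub (LinearMap.adjoint B)]; abel
  rw [key, inner_sub_left, inner_sub_left, inner_sub_left, LinearMap.adjoint_inner_left,
    LinearMap.adjoint_inner_left, hBY, hYZ] at h1
  rw [← hYZ] at h1
  have e1 : inner ℝ (-(S (n + 1) - s)) (Y (n + 1) - y) =
      - inner ℝ (S (n + 1) - s) (Z (n + 1) - y)
      - σ⁻¹ * inner ℝ (S (n + 1) - S n) (S (n + 1) - s) := by
    rw [hYZ, inner_neg_left, inner_add_right, real_inner_smul_right,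
      real_inner_comm (S (n + 1) - S n)]
    ring
  have e2 : inner ℝ (σ • (Z (n + 1) - Z n)) (Y (n + 1) - y) =
      σ * inner ℝ (Z (n + 1) - Z n) (Z (n + 1) - y)
      + inner ℝ (S (n + 1) - S n) (Z (n + 1) - Z n) := by
    rw [hYZ, real_inner_smul_left, inner_add_right, real_inner_smul_right,
      real_inner_comm (S (n + 1) - S n)]
    field_simp
  have e3 : inner ℝ (D (n + 1) - d) (D (n + 1) - D n)
      = inner ℝ (D (n + 1) - D n) (D (n + 1) - d) := real_inner_comm _ _
  rw [e1, e2, e3, map_sub C, map_sub C] at h1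
  have eS' : σ⁻¹ * inner ℝ (S (n + 1) - S n) (S (n + 1) - s) =
      (‖S (n + 1) - s‖ ^ 2 / σ - ‖S n - s‖ ^ 2 / σ + ‖S (n + 1) - S n‖ ^ 2 / σ) / 2 := by
    rw [eq_div_iff two_ne_zero, mul_assoc, mul_comm _ (2 : ℝ), eS]; ring
  have eZ' : σ * inner ℝ (Z (n + 1) - Z n) (Z (n + 1) - y) =
      (σ * ‖Z (n + 1) - y‖ ^ 2 - σ * ‖Z n - y‖ ^ 2 + σ * ‖Z (n + 1) - Z n‖ ^ 2) / 2 := by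
    rw [eq_div_iff two_ne_zero, mul_assoc, mul_comm _ (2 : ℝ), eZ]; ring
  simp only [lyapunov, map_sub C]
  linarith

/-- Convergence of the alternating direction method for a monotone inclusion, in terms of a
closed monotone sequence of pairs `(W n, Y n)`, `(S n, Z n)`. -/
theorem exists_tendsto_of_monotone (B : H →ₗ[ℝ] H₁) (C : H →ₗ[ℝ] H₂) {σ : ℝ} (hσ : 0 < σ)
    {Y Z S W : ℕ → H} {D : ℕ → H₁}
    (hD : ∀ n, D (n + 1) = D n + B (Y (n + 1)))
    (hS : ∀ n, S (n + 1) = S n + σ • (Y (n + 1) - Z (n + 1)))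
    (hW : ∀ n, W (n + 1) = -S (n + 1) - LinearMap.adjoint B (D (n + 1))
      - σ • (Z (n + 1) - Z n) - LinearMap.adjoint C (C (Y (n + 1) - Y n)))
    (monoW : ∀ m n, 0 ≤ inner ℝ (W m - W n) (Y m - Y n))
    (monoS : ∀ m n, 0 ≤ inner ℝ (S m - S n) (Z m - Z n))
    (star : ∃ y s : H, ∃ d : H₁, B y = 0 ∧
      (∀ n, 0 ≤ inner ℝ (W n - (-s - LinearMap.adjoint B d)) (Y n - y)) ∧
      ∀ n, 0 ≤ inner ℝ (S n - s) (Z n - y)) :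
    ∃ y s : H, ∃ d : H₁, B y = 0 ∧ Tendsto Y atTop (𝓝 y) ∧ Tendsto Z atTop (𝓝 y) ∧
      Tendsto S atTop (𝓝 s) ∧ Tendsto W atTop (𝓝 (-s - LinearMap.adjoint B d)) := by
  obtain ⟨y₀, s₀, d₀, hy₀, hw₀, hs₀⟩ := star
  have desc := lyapunov_descent B C hσ hD hS hW monoS hy₀ hw₀ hs₀
  set V := lyapunov C σ Y Z S D y₀ s₀ d₀ with hV
  have Vnn : ∀ n, 0 ≤ V n := fun n => by rw [hV]; unfold lyapunov; positivity
  have Vanti : Antitone V := antitone_nat_of_succ_le fun n => by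
    have := desc n
    have : 0 ≤ ‖S (n + 1) - S n‖ ^ 2 / σ + ‖D (n + 1) - D n‖ ^ 2
      + σ * ‖Z (n + 1) - Z n‖ ^ 2 + ‖C (Y (n + 1)) - C (Y n)‖ ^ 2 := by positivity
    linarith
  have Vlim := tendsto_atTop_ciInf Vanti ⟨0, by rintro _ ⟨n, rfl⟩; exact Vnn n⟩
  have Vdiff : Tendsto (fun n => V n - V (n + 1)) atTop (𝓝 0) := by
    simpa using Vlim.sub (Vlim.comp (tendsto_add_atTop_nat 1))
  have dS : Tendsto (fun n => S (n + 1) - S n) atTop (𝓝 0) := by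
    refine tendsto_zero_of_sq_le (c := σ) Vdiff fun n => ?_
    have h2 : 0 ≤ ‖D (n + 1) - D n‖ ^ 2 := by positivity
    have h3 : 0 ≤ σ * ‖Z (n + 1) - Z n‖ ^ 2 := by positivity
    have h4 : 0 ≤ ‖C (Y (n + 1)) - C (Y n)‖ ^ 2 := by positivity
    rw [← div_le_iff₀' hσ]; linarith [desc n]
  have dD : Tendsto (fun n => D (n + 1) - D n) atTop (𝓝 0) := by
    refine tendsto_zero_of_sq_le (c := 1) Vdiff fun n => ?_
    have h2 : 0 ≤ ‖S (n + 1) - S n‖ ^ 2 / σ := by positivity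
    have h3 : 0 ≤ σ * ‖Z (n + 1) - Z n‖ ^ 2 := by positivity
    have h4 : 0 ≤ ‖C (Y (n + 1)) - C (Y n)‖ ^ 2 := by positivity
    linarith [desc n]
  have dZ : Tendsto (fun n => Z (n + 1) - Z n) atTop (𝓝 0) := by
    refine tendsto_zero_of_sq_le (c := σ⁻¹) Vdiff fun n => ?_
    have h2 : 0 ≤ ‖S (n + 1) - S n‖ ^ 2 / σ := by positivity
    have h3 : 0 ≤ ‖D (n + 1) - D n‖ ^ 2 := by positivity
    have h4 : 0 ≤ ‖C (Y (n + 1)) - C (Y n)‖ ^ 2 := by positivity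
    rw [← div_eq_inv_mul, le_div_iff₀' hσ]; linarith [desc n]
  have dYZ : Tendsto (fun n => Y n - Z n) atTop (𝓝 0) := by
    rw [← tendsto_add_atTop_iff_nat 1]
    have := dS.const_smul σ⁻¹
    rw [smul_zero] at this
    refine this.congr fun n => ?_
    rw [hS n, add_sub_cancel_left, smul_smul, inv_mul_cancel₀ hσ.ne', one_smul]
  have dY : Tendsto (fun n => Y (n + 1) - Y n) atTop (𝓝 0) := by
    have h := ((dYZ.comp (tendsto_add_atTop_nat 1)).add dZ).sub dYZ
    simp only [add_zero, sub_zero] at h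
    refine h.congr fun n => ?_
    simp only [Function.comp]; abel
  have hBY : Tendsto (fun n => B (Y n)) atTop (𝓝 0) := by
    rw [← tendsto_add_atTop_iff_nat 1]
    refine dD.congr fun n => ?_
    rw [hD n, add_sub_cancel_left]
  have cB : Continuous B := B.continuous_of_finiteDimensional
  have cB' : Continuous (LinearMap.adjoint B) := LinearMap.continuous_of_finiteDimensional _
  have cC : Continuous C := C.continuous_of_finiteDimensional
  have cC' : Continuous (LinearMap.adjoint C) := LinearMap.continuous_of_finiteDimensional _
  -- The inclusion holds exactly up to increments, all of which vanish.
  have hWt : Tendsto (fun n => W n - (-S n - LinearMap.adjoint B (D n))) atTop (𝓝 0) := by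
    rw [← tendsto_add_atTop_iff_nat 1]
    have h := ((dZ.const_smul σ).add (((cC'.comp cC).tendsto 0).comp dY)).neg
    rw [Function.comp_apply, map_zero, map_zero, smul_zero, add_zero, neg_zero] at h
    refine h.congr fun n => ?_
    rw [hW n]; simp only [Function.comp]; abel
  obtain ⟨⟨s, d, y⟩, -, φ, hφ, hlim⟩ := tendsto_subseq_of_bounded
    (x := fun n => (S n, D n, Z n))
    (s := Metric.closedBall s₀ (√(σ * V 0)) ×ˢ Metric.closedBall d₀ (√(1 * V 0)) ×ˢ
      Metric.closedBall y₀ (√(σ⁻¹ * V 0)))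
    (Metric.isBounded_closedBall.prod (Metric.isBounded_closedBall.prod
      Metric.isBounded_closedBall)) (fun n => by
      obtain ⟨h1, h2, h3⟩ := lyapunov_bounds C hσ Y Z S D y₀ s₀ d₀ n
      have h0 := Vanti (Nat.zero_le n)
      refine ⟨?_, ?_, ?_⟩ <;> rw [mem_closedBall_iff_norm] <;> apply Real.le_sqrt_of_sq_le
      · exact h1.trans (by gcongr)
      · exact h2.trans (by gcongr)
      · exact h3.trans (by gcongr))
  have lS : Tendsto (fun n => S (φ n)) atTop (𝓝 s) := (continuous_fst.tendsto _).comp hlim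
  have lD : Tendsto (fun n => D (φ n)) atTop (𝓝 d) :=
    ((continuous_fst.comp continuous_snd).tendsto _).comp hlim
  have lZ : Tendsto (fun n => Z (φ n)) atTop (𝓝 y) :=
    ((continuous_snd.comp continuous_snd).tendsto _).comp hlim
  have lY : Tendsto (fun n => Y (φ n)) atTop (𝓝 y) := by
    simpa using (dYZ.comp hφ.tendsto_atTop).add lZ
  have lW : Tendsto (fun n => W (φ n)) atTop (𝓝 (-s - LinearMap.adjoint B d)) := by
    simpa using (hWt.comp hφ.tendsto_atTop).add (lS.neg.sub ((cB'.tendsto d).comp lD))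
  have hy : B y = 0 :=
    tendsto_nhds_unique ((cB.tendsto y).comp lY) (hBY.comp hφ.tendsto_atTop)
  -- Monotonicity between iterates `n` and `φ m`, with `m → ∞`, makes the cluster point a new
  -- reference point; maximality of the operators is not needed.
  have hw : ∀ n, 0 ≤ inner ℝ (W n - (-s - LinearMap.adjoint B d)) (Y n - y) := fun n =>
    ge_of_tendsto ((lW.const_sub (W n)).inner (lY.const_sub (Y n)))
      (Eventually.of_forall fun m => monoW n (φ m))
  have hs : ∀ n, 0 ≤ inner ℝ (S n - s) (Z n - y) := fun n =>
    ge_of_tendsto ((lS.const_sub (S n)).inner (lZ.const_sub (Z n)))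
      (Eventually.of_forall fun m => monoS n (φ m))
  have desc' := lyapunov_descent B C hσ hD hS hW monoS hy hw hs
  have bd := lyapunov_bounds C hσ Y Z S D y s d
  have hsub : Tendsto (fun n => lyapunov C σ Y Z S D y s d (φ n)) atTop (𝓝 0) := by
    have h1 : Tendsto (fun n => S (φ n) - s) atTop (𝓝 0) := by simpa using lS.sub_const s
    have h2 : Tendsto (fun n => D (φ n) - d) atTop (𝓝 0) := by simpa using lD.sub_const d
    have h3 : Tendsto (fun n => Z (φ n) - y) atTop (𝓝 0) := by simpa using lZ.sub_const y
    have h4 : Tendsto (fun n => C (Y (φ n) - y)) atTop (𝓝 0) := by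
      have := (cC.tendsto (y - y)).comp (lY.sub_const y)
      rwa [sub_self, map_zero] at this
    have := (((h1.norm.pow 2).div_const σ).add (h2.norm.pow 2)).add
      ((h3.norm.pow 2).const_mul σ) |>.add (h4.norm.pow 2)
    simpa [lyapunov] using this
  set V' := lyapunov C σ Y Z S D y s d with hV'
  have V'nn : ∀ n, 0 ≤ V' n := fun n => by rw [hV']; unfold lyapunov; positivity
  have V'anti : Antitone V' := antitone_nat_of_succ_le fun n => by
    have := desc' n
    have : 0 ≤ ‖S (n + 1) - S n‖ ^ 2 / σ + ‖D (n + 1) - D n‖ ^ 2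
      + σ * ‖Z (n + 1) - Z n‖ ^ 2 + ‖C (Y (n + 1)) - C (Y n)‖ ^ 2 := by positivity
    linarith
  have V'lim := tendsto_atTop_ciInf V'anti ⟨0, by rintro _ ⟨n, rfl⟩; exact V'nn n⟩
  -- An antitone sequence with a subsequence tending to zero tends to zero.
  rw [tendsto_nhds_unique (V'lim.comp hφ.tendsto_atTop) hsub] at V'lim
  have fS : Tendsto S atTop (𝓝 s) :=
    tendsto_sub_nhds_zero_iff.1 (tendsto_zero_of_sq_le V'lim fun n => (bd n).1)
  have fD : Tendsto D atTop (𝓝 d) :=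
    tendsto_sub_nhds_zero_iff.1 (tendsto_zero_of_sq_le V'lim fun n => (bd n).2.1)
  have fZ : Tendsto Z atTop (𝓝 y) :=
    tendsto_sub_nhds_zero_iff.1 (tendsto_zero_of_sq_le V'lim fun n => (bd n).2.2)
  refine ⟨y, s, d, hy, ?_, fZ, fS, ?_⟩
  · simpa using dYZ.add fZ
  · simpa using hWt.add (fS.neg.sub ((cB'.tendsto d).comp fD))

end Lyapunov

/-! ### Polar cones, projections and normal vectors -/

section Cone

variable {F : Type*} [NormedAddCommGroup F] [InnerProductSpace ℝ F]

theorem convex_polarCone (K : Set F) : Convex ℝ (polarCone K) := by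
  intro u hu v hv a b ha hb _ x hx
  rw [inner_add_right, real_inner_smul_right, real_inner_smul_right]
  have h1 := mul_nonneg ha (neg_nonneg.2 (hu x hx))
  have h2 := mul_nonneg hb (neg_nonneg.2 (hv x hx))
  linarith

theorem isClosed_polarCone (K : Set F) : IsClosed (polarCone K) := by
  have : polarCone K = ⋂ x ∈ K, {y | inner ℝ x y ≤ 0} := by ext; simp [polarCone]
  rw [this]
  exact isClosed_biInter fun x _ => isClosed_le (by fun_prop) continuous_const

theorem zero_mem_polarCone (K : Set F) : (0 : F) ∈ polarCone K := fun x _ => by simp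

theorem smul_mem_polarCone {K : Set F} {y : F} (hy : y ∈ polarCone K) {t : ℝ} (ht : 0 ≤ t) :
    t • y ∈ polarCone K := fun x hx => by
  rw [real_inner_smul_right]
  exact mul_nonpos_of_nonneg_of_nonpos ht (hy x hx)

/-- The variational characterization of the projection onto a convex set. -/
theorem IsProjection.inner_le_zero {C : Set F} (hC : Convex ℝ C) {v z : F}
    (h : IsProjection C v z) {w : F} (hw : w ∈ C) : inner ℝ (v - z) (w - z) ≤ 0 := by
  have : Nonempty C := ⟨⟨z, h.1⟩⟩
  refine (norm_eq_iInf_iff_real_inner_le_zero hC h.1).1 (le_antisymm ?_ ?_) w hw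
  · exact le_ciInf fun u => h.2 u.2
  · exact ciInf_le (f := fun u : C => ‖v - u‖) ⟨0, by rintro _ ⟨u, rfl⟩; positivity⟩ ⟨z, h.1⟩

/-- A normal vector to the polar cone at `y` is orthogonal to `y`. -/
theorem inner_eq_zero_of_normal_polarCone {K : Set F} {s y : F} (hy : y ∈ polarCone K)
    (h : ∀ v ∈ polarCone K, inner ℝ s (v - y) ≤ 0) : inner ℝ s y = 0 := by
  -- Testing with `0` and `2 • y` gives the two signs.
  have h1 := h _ (zero_mem_polarCone K)
  have h2 := h _ (smul_mem_polarCone hy zero_le_two)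
  rw [zero_sub, inner_neg_right] at h1
  rw [two_smul, add_sub_cancel_right] at h2
  linarith

/-- The bipolar theorem. -/
theorem mem_of_forall_polarCone [CompleteSpace F] (K : ConvexCone ℝ F)
    (hne : (K : Set F).Nonempty) (hcl : IsClosed (K : Set F)) {s : F}
    (h : ∀ v ∈ polarCone (K : Set F), inner ℝ s v ≤ 0) : s ∈ K := by
  lift K to ProperCone ℝ F using ⟨hne, hcl⟩
  by_contra hs
  obtain ⟨y, hy, hsy⟩ := ProperCone.hyperplane_separation' K (x₀ := s) hs
  have := h (-y) fun x hx => by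
    rw [inner_neg_right]; exact neg_nonpos.2 (hy x hx)
  rw [inner_neg_right] at this
  linarith

theorem mem_of_normal_polarCone [CompleteSpace F] (K : ConvexCone ℝ F)
    (hne : (K : Set F).Nonempty) (hcl : IsClosed (K : Set F)) {s y : F}
    (hy : y ∈ polarCone (K : Set F))
    (h : ∀ v ∈ polarCone (K : Set F), inner ℝ s (v - y) ≤ 0) : s ∈ K :=
  mem_of_forall_polarCone K hne hcl fun v hv => by
    have := h v hv
    rwa [inner_sub_right, inner_eq_zero_of_normal_polarCone hy h, sub_zero] at this

end Cone

/-! ### Subgradients, conjugates and their limits -/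

section Subgradient

variable {E : Type*} [NormedAddCommGroup E] [InnerProductSpace ℝ E]
  {F : Type*} [NormedAddCommGroup F] [InnerProductSpace ℝ F]

/-- The point `x` is in the domain of `f`, and `-A^* y` is a subgradient of `f` at `x`. -/
def IsNegSubgradient (f : E → EReal) (A : E →ₗ[ℝ] F) (x : E) (y : F) : Prop :=
  f x ≠ ⊤ ∧ ∀ u, f x ≤ f u + ((inner ℝ y (A (u - x)) : ℝ) : EReal)

/-- Optimality condition for the regularized minimization of a convex function. -/
theorem isNegSubgradient_of_isMinOn {f : E → EReal} (hf : ConvexFun f) (hp : ProperFun f)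
    (A : E →ₗ[ℝ] F) (r : F) (c : ℝ) {x : E}
    (h : IsMinOn (fun u : E => f u + ((1 / (2 * c) * ‖A u + r‖ ^ 2 : ℝ) : EReal)) Set.univ x) :
    IsNegSubgradient f A x ((1 / c) • (A x + r)) := by
  have hmin : ∀ u, f x + ((1 / (2 * c) * ‖A x + r‖ ^ 2 : ℝ) : EReal) ≤
      f u + ((1 / (2 * c) * ‖A u + r‖ ^ 2 : ℝ) : EReal) := fun u => h (Set.mem_univ u)
  have hx : f x ≠ ⊤ := by
    obtain ⟨u, hu⟩ := hp.2
    intro hx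
    have := hmin u
    rw [hx, EReal.top_add_coe, top_le_iff] at this
    lift f u to ℝ using ⟨hu, hp.1 u⟩ with a
    exact EReal.coe_ne_top _ (by rw [EReal.coe_add]; exact this)
  refine ⟨hx, fun u => ?_⟩
  rcases eq_or_ne (f u) ⊤ with hu | hu
  · rw [hu, EReal.top_add_coe]; exact le_top
  obtain ⟨a, ha⟩ : ∃ a : ℝ, f x = a := ⟨(f x).toReal, (EReal.coe_toReal hx (hp.1 x)).symm⟩
  obtain ⟨b, hb⟩ : ∃ b : ℝ, f u = b := ⟨(f u).toReal, (EReal.coe_toReal hu (hp.1 u)).symm⟩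
  rw [ha, hb, ← EReal.coe_add, EReal.coe_le_coe_iff]
  -- Compare `x` with `(1 - t) • x + t • u`, use convexity and divide by `t`; the quadratic
  -- remainder is of order `t`.
  have step : ∀ t ∈ Set.Ioc (0 : ℝ) 1, a - b - inner ℝ ((1 / c) • (A x + r)) (A (u - x)) ≤
      t * (1 / (2 * c) * ‖A (u - x)‖ ^ 2) := by
    rintro t ⟨ht0, ht1⟩
    have hconv := hf (x := (x, a)) (by simp [ha]) (y := (u, b)) (by simp [hb])
      (sub_nonneg.2 ht1) ht0.le (by ring)
    have hle : f ((1 - t) • x + t • u) ≤ (((1 - t) * a + t * b : ℝ) : EReal) := hconv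
    have h1 := (hmin ((1 - t) • x + t • u)).trans (add_le_add_left hle _)
    rw [ha, ← EReal.coe_add, ← EReal.coe_add, EReal.coe_le_coe_iff] at h1
    have e : A ((1 - t) • x + t • u) + r = (A x + r) + t • A (u - x) := by
      simp only [map_add, map_smul, map_sub]; module
    rw [e, norm_add_sq_real (A x + r), norm_smul, real_inner_smul_right, mul_pow, Real.norm_eq_abs,
      sq_abs] at h1
    rw [real_inner_smul_left]
    have h2 : t * (a - b - 1 / c * inner ℝ (A x + r) (A (u - x))) ≤
        t * (t * (1 / (2 * c) * ‖A (u - x)‖ ^ 2)) := by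
      have : 1 / (2 * c) * (2 * (t * inner ℝ (A x + r) (A (u - x)))) =
          t * (1 / c * inner ℝ (A x + r) (A (u - x))) := by
        rw [one_div, mul_inv]; ring
      linarith
    exact le_of_mul_le_mul_left h2 ht0
  have lim : Tendsto (fun t : ℝ => t * (1 / (2 * c) * ‖A (u - x)‖ ^ 2)) (𝓝[>] 0) (𝓝 0) := by
    have : Continuous (fun t : ℝ => t * (1 / (2 * c) * ‖A (u - x)‖ ^ 2)) := by fun_prop
    simpa using (this.tendsto 0).mono_left nhdsWithin_le_nhds
  have := ge_of_tendsto lim (by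
    filter_upwards [Ioc_mem_nhdsGT (zero_lt_one' ℝ)] with t ht using step t ht)
  linarith

theorem IsNegSubgradient.monotone {f : E → EReal} (hp : ProperFun f) {A : E →ₗ[ℝ] F}
    {x x' : E} {y y' : F} (h : IsNegSubgradient f A x y) (h' : IsNegSubgradient f A x' y') :
    inner ℝ (y - y') (A x - A x') ≤ 0 := by
  have h1 := h.2 x'
  have h2 := h'.2 x
  obtain ⟨a, ha⟩ : ∃ a : ℝ, f x = a := ⟨(f x).toReal, (EReal.coe_toReal h.1 (hp.1 x)).symm⟩
  obtain ⟨b, hb⟩ : ∃ b : ℝ, f x' = b := ⟨(f x').toReal, (EReal.coe_toReal h'.1 (hp.1 x')).symm⟩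
  rw [ha, hb, ← EReal.coe_add, EReal.coe_le_coe_iff, map_sub, inner_sub_right] at h1 h2
  rw [inner_sub_left, inner_sub_right, inner_sub_right]
  linarith

/-- Subgradients are preserved under limits along cluster points. -/
theorem IsNegSubgradient.of_tendsto {f : E → EReal} (hp : ProperFun f)
    (hlsc : LowerSemicontinuous f) {A : E →ₗ[ℝ] F} (hA : Continuous A)
    {x : ℕ → E} {y : ℕ → F} {x₀ : E} {y₀ : F} (h : ∀ n, IsNegSubgradient f A (x n) (y n))
    (hx : Tendsto x atTop (𝓝 x₀)) (hy : Tendsto y atTop (𝓝 y₀)) :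
    IsNegSubgradient f A x₀ y₀ := by
  have key : ∀ u, f u ≠ ⊤ → f x₀ ≤ f u + ((inner ℝ y₀ (A (u - x₀)) : ℝ) : EReal) := by
    intro u hu
    obtain ⟨b, hb⟩ : ∃ b : ℝ, f u = b := ⟨(f u).toReal, (EReal.coe_toReal hu (hp.1 u)).symm⟩
    have lim : Tendsto (fun n => b + inner ℝ (y n) (A (u - x n))) atTop
        (𝓝 (b + inner ℝ y₀ (A (u - x₀)))) :=
      (hy.inner ((hA.tendsto _).comp (hx.const_sub u))).const_add b
    refine le_of_forall_lt fun c hc => ?_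
    obtain ⟨c', hc1, hc2⟩ := exists_between hc
    rw [hb, ← EReal.coe_add]
    have lim' := (continuous_coe_real_ereal.tendsto _).comp lim
    refine hc1.trans_le (ge_of_tendsto lim' ?_)
    filter_upwards [hx.eventually (hlsc x₀ c' hc2)] with n hn
    have := (h n).2 u
    rw [hb, ← EReal.coe_add] at this
    exact hn.le.trans this
  obtain ⟨u, hu⟩ := hp.2
  refine ⟨fun htop => ?_, fun v => ?_⟩
  · have := key u hu
    rw [htop, top_le_iff] at this
    lift f u to ℝ using ⟨hu, hp.1 u⟩ with a
    exact EReal.coe_ne_top _ (by rw [EReal.coe_add]; exact this)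
  · rcases eq_or_ne (f v) ⊤ with hv | hv
    · rw [hv, EReal.top_add_coe]; exact le_top
    · exact key v hv

/-- The Fenchel-Young inequality. -/
theorem inner_sub_le_conjugate (f : E → EReal) (u x : E) :
    ((inner ℝ u x : ℝ) : EReal) - f x ≤ conjugate f u :=
  le_iSup (fun x => ((inner ℝ u x : ℝ) : EReal) - f x) x

theorem conjugate_ne_bot {f : E → EReal} (hp : ProperFun f) (u : E) : conjugate f u ≠ ⊥ := by
  obtain ⟨x, hx⟩ := hp.2
  obtain ⟨a, ha⟩ : ∃ a : ℝ, f x = a := ⟨(f x).toReal, (EReal.coe_toReal hx (hp.1 x)).symm⟩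
  have := inner_sub_le_conjugate f u x
  rw [ha, ← EReal.coe_sub] at this
  intro h
  rw [h, le_bot_iff] at this
  exact EReal.coe_ne_bot _ this

variable [FiniteDimensional ℝ E] [FiniteDimensional ℝ F]

/-- The limit of the subgradient inequality for the function `y ↦ f^*(-A^* y)`. -/
theorem conjugate_le_of_tendsto {f : E → EReal} (hp : ProperFun f) {A : E →ₗ[ℝ] F}
    {x : ℕ → E} {y : ℕ → F} {y₀ a : F} (h : ∀ n, IsNegSubgradient f A (x n) (y n))
    (hy : Tendsto y atTop (𝓝 y₀)) (ha : Tendsto (fun n => A (x n)) atTop (𝓝 a)) (v : F) :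
    conjugate f (-(LinearMap.adjoint A y₀)) ≤
      conjugate f (-(LinearMap.adjoint A v)) + ((inner ℝ (v - y₀) a : ℝ) : EReal) := by
  rcases eq_or_ne (conjugate f (-(LinearMap.adjoint A v))) ⊤ with ht | ht
  · rw [ht, EReal.top_add_coe]; exact le_top
  obtain ⟨c, hc⟩ : ∃ c : ℝ, conjugate f (-(LinearMap.adjoint A v)) = c :=
    ⟨_, (EReal.coe_toReal ht (conjugate_ne_bot hp _)).symm⟩
  refine iSup_le fun u => ?_
  rcases eq_or_ne (f u) ⊤ with hu | hu
  · rw [hu, sub_eq_add_neg, EReal.neg_top, EReal.add_bot]; exact bot_le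
  obtain ⟨b, hb⟩ : ∃ b : ℝ, f u = b := ⟨(f u).toReal, (EReal.coe_toReal hu (hp.1 u)).symm⟩
  rw [hc, hb, ← EReal.coe_sub, ← EReal.coe_add, EReal.coe_le_coe_iff, inner_neg_left,
    LinearMap.adjoint_inner_left]
  -- Adding the subgradient inequality at `x n` to Fenchel-Young for `v` and `x n` cancels `f (x
  -- n)`. Only `y n` and `A (x n)` remain, so `x` need not converge.
  refine le_of_tendsto_of_tendsto' (((hy.inner tendsto_const_nhds).neg).sub_const b)
    ((hy.const_sub v).inner ha |>.const_add c) fun n => ?_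
  have h1 := (h n).2 u
  have h2 := inner_sub_le_conjugate f (-(LinearMap.adjoint A v)) (x n)
  obtain ⟨d, hd⟩ : ∃ d : ℝ, f (x n) = d :=
    ⟨_, (EReal.coe_toReal (h n).1 (hp.1 (x n))).symm⟩
  rw [hc, hd, ← EReal.coe_sub, EReal.coe_le_coe_iff, inner_neg_left,
    LinearMap.adjoint_inner_left] at h2
  rw [hb, hd, ← EReal.coe_add, EReal.coe_le_coe_iff, map_sub, inner_sub_right] at h1
  rw [inner_sub_left]
  linarith

end Subgradient
-- Finite sums of extended reals
section ERealSum

variable {α : Type*}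

theorem add_ne_bot {a b : EReal} (ha : a ≠ ⊥) (hb : b ≠ ⊥) : a + b ≠ ⊥ := fun h =>
  (EReal.add_eq_bot_iff.1 h).elim ha hb

theorem sum_ne_bot {s : Finset α} {a : α → EReal} (h : ∀ i ∈ s, a i ≠ ⊥) : ∑ i ∈ s, a i ≠ ⊥ :=
  Finset.sum_induction a (· ≠ ⊥) (fun _ _ => add_ne_bot) EReal.zero_ne_bot h

theorem sum_eq_top {s : Finset α} {a : α → EReal} (h : ∀ i ∈ s, a i ≠ ⊥) {i : α} (hi : i ∈ s)
    (hai : a i = ⊤) : ∑ i ∈ s, a i = ⊤ := by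
  classical
  rw [← Finset.add_sum_erase s a hi, hai]
  exact EReal.top_add_of_ne_bot (sum_ne_bot fun j hj => h j (Finset.mem_of_mem_erase hj))

theorem coe_sum (s : Finset α) (a : α → ℝ) :
    ((∑ i ∈ s, a i : ℝ) : EReal) = ∑ i ∈ s, (a i : EReal) :=
  map_sum (⟨⟨Real.toEReal, EReal.coe_zero⟩, EReal.coe_add⟩ : ℝ →+ EReal) a s

end ERealSum

/-! ### Edge maps and graph Laplacians -/

section Graph

variable {ι : Type*} {F : Type*} [NormedAddCommGroup F] [InnerProductSpace ℝ F]
  (G : SimpleGraph ι) [DecidableRel G.Adj]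

/-- The map sending `x` to the family `√(ρ / 2) • (x i + ε • x j)` over the ordered pairs of
adjacent vertices. -/
noncomputable def edgeMap (ρ ε : ℝ) :
    PiLp 2 (fun _ : ι => F) →ₗ[ℝ] PiLp 2 (fun _ : ι × ι => F) where
  toFun x := WithLp.toLp 2 fun e =>
    if G.Adj e.1 e.2 then √(ρ / 2) • (x e.1 + ε • x e.2) else 0
  map_add' x y := by
    ext e
    simp only [PiLp.add_apply]
    split_ifs
    · module
    · simp
  map_smul' t x := by
    ext e
    simp only [PiLp.smul_apply, RingHom.id_apply]
    split_ifs
    · module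
    · simp

theorem edgeMap_apply (ρ ε : ℝ) (x : PiLp 2 (fun _ : ι => F)) (e : ι × ι) :
    edgeMap G ρ ε x e = if G.Adj e.1 e.2 then √(ρ / 2) • (x e.1 + ε • x e.2) else 0 := rfl

theorem edgeMap_neg_one_const (ρ : ℝ) (c : F) :
    edgeMap G ρ (-1) (WithLp.toLp 2 fun _ => c) = 0 := by
  ext e
  simp [edgeMap_apply]

variable {G}

theorem eq_of_edgeMap_eq_zero (hG : G.Connected) {ρ : ℝ} (hρ : 0 < ρ)
    {x : PiLp 2 (fun _ : ι => F)} (hx : edgeMap G ρ (-1) x = 0) (i j : ι) : x i = x j := by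
  have hadj : ∀ i j, G.Adj i j → x i = x j := fun i j hij => by
    have h := congrArg (fun w : PiLp 2 (fun _ : ι × ι => F) => w (i, j)) hx
    simp only [edgeMap_apply, hij, if_true, PiLp.zero_apply] at h
    have hs : √(ρ / 2) ≠ 0 := (Real.sqrt_pos.2 (by positivity)).ne'
    have := (smul_eq_zero.1 h).resolve_left hs
    rwa [neg_one_smul, ← sub_eq_add_neg, sub_eq_zero] at this
  obtain ⟨w⟩ := hG.preconnected i j
  induction w with
  | nil => rfl
  | cons h _ ih => exact (hadj _ _ h).trans ih

variable [Fintype ι]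

variable (G) in
-- Ordered pairs count each edge twice, hence the weight `ρ / 2`. Since `ε² = 1`, the product on a
-- pair is a term at one endpoint plus its mirror image at the other. The signs `-1` and `1` give
-- the Laplacian and the signless Laplacian.
theorem inner_edgeMap_edgeMap {ρ ε : ℝ} (hρ : 0 ≤ ρ) (hε : ε * ε = 1)
    (x v : PiLp 2 (fun _ : ι => F)) :
    inner ℝ (edgeMap G ρ ε x) (edgeMap G ρ ε v) =
      ∑ i, inner ℝ (ρ • ∑ j ∈ G.neighborFinset i, (x i + ε • x j)) (v i) := by
  have h1 : inner ℝ (edgeMap G ρ ε x) (edgeMap G ρ ε v) =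
      ∑ i, ∑ j, ((if G.Adj i j then ρ / 2 * inner ℝ (x i + ε • x j) (v i) else 0) +
        (if G.Adj j i then ρ / 2 * inner ℝ (x j + ε • x i) (v j) else 0)) := by
    rw [PiLp.inner_apply, Fintype.sum_prod_type]
    refine Finset.sum_congr rfl fun i _ => Finset.sum_congr rfl fun j _ => ?_
    rw [edgeMap_apply, edgeMap_apply]
    simp only [G.adj_comm j i]
    split_ifs
    · have hs : √(ρ / 2) * √(ρ / 2) = ρ / 2 := Real.mul_self_sqrt (by positivity)
      simp only [real_inner_smul_left, real_inner_smul_right, inner_add_left, inner_add_right]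
      linear_combination (inner ℝ (x i) (v i) + ε * inner ℝ (x i) (v j)
        + ε * inner ℝ (x j) (v i) + ε * ε * inner ℝ (x j) (v j)) * hs
        + ρ / 2 * inner ℝ (x j) (v j) * hε
    · simp
  have h2 : ∀ i, inner ℝ (ρ • ∑ j ∈ G.neighborFinset i, (x i + ε • x j)) (v i) =
      ∑ j, (2 * if G.Adj i j then ρ / 2 * inner ℝ (x i + ε • x j) (v i) else 0) := by
    intro i
    rw [real_inner_smul_left, sum_inner, SimpleGraph.neighborFinset_eq_filter,
      Finset.sum_filter, Finset.mul_sum]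
    refine Finset.sum_congr rfl fun j _ => ?_
    split_ifs <;> ring
  rw [h1, Finset.sum_congr rfl fun i _ => h2 i]
  simp only [Finset.sum_add_distrib]
  rw [Finset.sum_comm (f := fun i j => if G.Adj j i then
    ρ / 2 * inner ℝ (x j + ε • x i) (v j) else 0)]
  simp only [← Finset.mul_sum]
  ring

variable [FiniteDimensional ℝ F]

variable (G) in
theorem adjoint_edgeMap_edgeMap {ρ ε : ℝ} (hρ : 0 ≤ ρ)
    (hε : ε * ε = 1) (x : PiLp 2 (fun _ : ι => F)) :
    LinearMap.adjoint (edgeMap G ρ ε) (edgeMap G ρ ε x) =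
      WithLp.toLp 2 fun i => ρ • ∑ j ∈ G.neighborFinset i, (x i + ε • x j) := by
  refine ext_inner_right ℝ fun v => ?_
  rw [LinearMap.adjoint_inner_left, inner_edgeMap_edgeMap G hρ hε, PiLp.inner_apply]

variable (G) in
theorem sum_adjoint_edgeMap (ρ : ℝ) (d : PiLp 2 (fun _ : ι × ι => F)) :
    ∑ i, LinearMap.adjoint (edgeMap G ρ (-1)) d i = 0 := by
  refine ext_inner_right ℝ fun c => ?_
  have h := LinearMap.adjoint_inner_left (edgeMap G ρ (-1)) (WithLp.toLp 2 fun _ => c) d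
  rw [edgeMap_neg_one_const, inner_zero_right, PiLp.inner_apply] at h
  rw [sum_inner, inner_zero_left, h]

theorem exists_adjoint_edgeMap_eq (hG : G.Connected) {ρ : ℝ} (hρ : 0 < ρ)
    {q : PiLp 2 (fun _ : ι => F)} (hq : ∑ i, q i = 0) :
    ∃ d, LinearMap.adjoint (edgeMap G ρ (-1)) d = q := by
  -- The range of the adjoint is the orthogonal complement of the kernel, which consists of constant
  -- families by connectedness.
  have : q ∈ (LinearMap.ker (edgeMap (F := F) G ρ (-1)))ᗮ := by
    rw [Submodule.mem_orthogonal]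
    intro u hu
    obtain ⟨i₀⟩ := hG.nonempty
    have hc := eq_of_edgeMap_eq_zero hG hρ (LinearMap.mem_ker.1 hu)
    rw [PiLp.inner_apply, Finset.sum_congr rfl fun i _ => by rw [hc i i₀], ← inner_sum, hq,
      inner_zero_right]
  rw [LinearMap.orthogonal_ker] at this
  exact this

end Graph

/-! ### Optimality conditions -/

namespace Problem

variable {ι : Type*} [Fintype ι] {E : ι → Type*} {F : Type*}
  [∀ i, NormedAddCommGroup (E i)] [∀ i, InnerProductSpace ℝ (E i)]
  [NormedAddCommGroup F] [InnerProductSpace ℝ F]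

/-- The Karush-Kuhn-Tucker conditions are sufficient for primal optimality. -/
theorem isPrimalMinimizer_of_kkt {P : Problem ι E F} {x : ∀ i, E i} {y : F}
    (hx : x ∈ P.feasible) (hy : y ∈ polarCone (P.K : Set F))
    (hsub : ∀ i, IsNegSubgradient (P.f i) (P.A i) (x i) y)
    (hc : inner ℝ (∑ i, (P.A i (x i) - P.b i)) y = 0) : P.IsPrimalMinimizer x := by
  refine ⟨hx, fun u hu => ?_⟩
  have hsum : (∑ i, inner ℝ y (P.A i (u i - x i)) : ℝ) ≤ 0 := by
    have e : ∑ i, P.A i (u i - x i) =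
        ∑ i, (P.A i (u i) - P.b i) - ∑ i, (P.A i (x i) - P.b i) := by
      rw [← Finset.sum_sub_distrib]
      exact Finset.sum_congr rfl fun i _ => by rw [map_sub]; abel
    rw [← inner_sum, e, inner_sub_right, real_inner_comm, real_inner_comm _ y, hc, sub_zero]
    exact hy _ hu
  calc P.primalObj x ≤ ∑ i, (P.f i (u i) + ((inner ℝ y (P.A i (u i - x i)) : ℝ) : EReal)) :=
        Finset.sum_le_sum fun i _ => (hsub i).2 (u i)
    _ = P.primalObj u + ((∑ i, inner ℝ y (P.A i (u i - x i)) : ℝ) : EReal) := by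
        rw [Finset.sum_add_distrib, coe_sum]; rfl
    _ ≤ P.primalObj u := by
        refine (add_le_add_right (EReal.coe_le_coe_iff.2 hsum) _).trans ?_
        rw [EReal.coe_zero, add_zero]

variable [∀ i, FiniteDimensional ℝ (E i)] [FiniteDimensional ℝ F]

theorem dualTerm_ne_bot {P : Problem ι E F} (hP : P.Assumptions) (y : F) (i : ι) :
    conjugate (P.f i) (-(LinearMap.adjoint (P.A i) y)) + ((inner ℝ y (P.b i) : ℝ) : EReal)
      + indicatorFun (polarCone (P.K : Set F)) y ≠ ⊥ := by
  refine add_ne_bot (add_ne_bot (conjugate_ne_bot (hP.proper i) _)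
    (EReal.coe_ne_bot _)) ?_
  unfold indicatorFun
  split_ifs <;> simp

/-- The Karush-Kuhn-Tucker conditions for a primal-dual solution with zero duality gap. -/
theorem Assumptions.exists_kkt [Nonempty ι] {P : Problem ι E F} (hP : P.Assumptions) :
    ∃ x y, x ∈ P.feasible ∧ y ∈ polarCone (P.K : Set F) ∧
      (∀ i, IsNegSubgradient (P.f i) (P.A i) (x i) y) ∧
      inner ℝ (∑ i, (P.A i (x i) - P.b i)) y = 0 := by
  obtain ⟨x, y, ⟨hxf, -⟩, -, heq⟩ := hP.exists_solution
  have hfb : ∀ i ∈ Finset.univ, P.f i (x i) ≠ ⊥ := fun i _ => (hP.proper i).1 _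
  have hgb : ∀ i ∈ Finset.univ, _ ≠ ⊥ := fun i _ => dualTerm_ne_bot hP y i
  unfold primalObj dualObj at heq
  -- The primal value is not `⊥` and the dual value is not `⊤`, so equality makes every term finite.
  have hft : ∀ i, P.f i (x i) ≠ ⊤ := fun i h => by
    rw [sum_eq_top hfb (Finset.mem_univ i) h, eq_comm, EReal.neg_eq_top_iff] at heq
    exact sum_ne_bot hgb heq
  have hgt : ∀ i, _ ≠ ⊤ := fun i h => by
    rw [sum_eq_top hgb (Finset.mem_univ i) h, EReal.neg_top] at heq
    exact sum_ne_bot hfb heq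
  have hy : y ∈ polarCone (P.K : Set F) := by
    by_contra hy
    obtain ⟨i⟩ := ‹Nonempty ι›
    refine hgt i ?_
    rw [indicatorFun, if_neg hy]
    exact EReal.add_top_of_ne_bot (add_ne_bot (conjugate_ne_bot (hP.proper i) _)
      (EReal.coe_ne_bot _))
  simp only [indicatorFun, if_pos hy, add_zero] at heq hgt
  have hct : ∀ i, conjugate (P.f i) (-(LinearMap.adjoint (P.A i) y)) ≠ ⊤ := fun i h => by
    apply hgt i
    rw [h, EReal.top_add_coe]
  have ha : ∀ i, P.f i (x i) = ((P.f i (x i)).toReal : EReal) := fun i =>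
    (EReal.coe_toReal (hft i) (hfb i (Finset.mem_univ i))).symm
  have hc : ∀ i, conjugate (P.f i) (-(LinearMap.adjoint (P.A i) y)) =
      ((conjugate (P.f i) (-(LinearMap.adjoint (P.A i) y))).toReal : EReal) := fun i =>
    (EReal.coe_toReal (hct i) (conjugate_ne_bot (hP.proper i) _)).symm
  set a := fun i => (P.f i (x i)).toReal
  set c := fun i => (conjugate (P.f i) (-(LinearMap.adjoint (P.A i) y))).toReal
  have hsum : ∑ i, a i = -∑ i, (c i + inner ℝ y (P.b i)) := by
    rw [← EReal.coe_eq_coe_iff, EReal.coe_neg, coe_sum, coe_sum]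
    simp only [EReal.coe_add]
    rw [← Finset.sum_congr rfl fun i _ => ha i, heq]
    exact congrArg _ (Finset.sum_congr rfl fun i _ => by rw [hc i])
  -- The Fenchel-Young gaps are nonnegative, yet sum to `⟪slack, y⟫ ≤ 0`. Hence each gap vanishes,
  -- which is the subgradient condition, and so does the product.
  have hδ : ∀ i ∈ Finset.univ, 0 ≤ c i + a i + inner ℝ y (P.A i (x i)) := fun i _ => by
    have h := inner_sub_le_conjugate (P.f i) (-(LinearMap.adjoint (P.A i) y)) (x i)
    rw [hc i, ha i, ← EReal.coe_sub, EReal.coe_le_coe_iff, inner_neg_left,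
      LinearMap.adjoint_inner_left] at h
    linarith
  have hδs : ∑ i, (c i + a i + inner ℝ y (P.A i (x i))) =
      inner ℝ (∑ i, (P.A i (x i) - P.b i)) y := by
    rw [real_inner_comm, inner_sum]
    simp only [inner_sub_right, Finset.sum_add_distrib, Finset.sum_sub_distrib] at hsum ⊢
    linarith
  have hle : inner ℝ (∑ i, (P.A i (x i) - P.b i)) y ≤ 0 := hy _ hxf
  have h0 : ∑ i, (c i + a i + inner ℝ y (P.A i (x i))) = 0 :=
    le_antisymm (hδs.trans_le hle) (Finset.sum_nonneg hδ)
  refine ⟨x, y, hxf, hy, fun i => ⟨hft i, fun u => ?_⟩, hδs ▸ h0⟩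
  have hi := (Finset.sum_eq_zero_iff_of_nonneg hδ).1 h0 i (Finset.mem_univ i)
  rcases eq_or_ne (P.f i u) ⊤ with hu | hu
  · rw [hu, EReal.top_add_coe]; exact le_top
  have h := inner_sub_le_conjugate (P.f i) (-(LinearMap.adjoint (P.A i) y)) u
  obtain ⟨b, hb⟩ : ∃ b : ℝ, P.f i u = b := ⟨_, (EReal.coe_toReal hu ((hP.proper i).1 u)).symm⟩
  rw [hc i, hb, ← EReal.coe_sub, EReal.coe_le_coe_iff, inner_neg_left,
    LinearMap.adjoint_inner_left] at h
  rw [ha i, hb, ← EReal.coe_add, EReal.coe_le_coe_iff, map_sub, inner_sub_right]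
  change a i ≤ _
  linarith

/-- A sufficient condition for dual optimality. -/
theorem isDualMaximizer_of_le {P : Problem ι E F} (hP : P.Assumptions) [Nonempty ι] {y : F}
    (hy : y ∈ polarCone (P.K : Set F)) {a : ι → F}
    (hconj : ∀ i v, conjugate (P.f i) (-(LinearMap.adjoint (P.A i) y)) ≤
      conjugate (P.f i) (-(LinearMap.adjoint (P.A i) v)) + ((inner ℝ (v - y) (a i) : ℝ) : EReal))
    (ha : ∀ v ∈ polarCone (P.K : Set F), inner ℝ (∑ i, (a i - P.b i)) (v - y) ≤ 0) :
    P.IsDualMaximizer y := by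
  intro v _
  refine EReal.neg_le_neg_iff.2 ?_
  by_cases hv : v ∈ polarCone (P.K : Set F)
  · have hsum : (∑ i, inner ℝ (v - y) (a i - P.b i) : ℝ) ≤ 0 := by
      rw [← inner_sum, real_inner_comm]; exact ha v hv
    simp only [indicatorFun, if_pos hv, if_pos hy, add_zero]
    calc _ ≤ ∑ i, (conjugate (P.f i) (-(LinearMap.adjoint (P.A i) v)) +
          ((inner ℝ v (P.b i) : ℝ) : EReal)
          + ((inner ℝ (v - y) (a i - P.b i) : ℝ) : EReal)) := by
          refine Finset.sum_le_sum fun i _ => ?_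
          refine (add_le_add_left (hconj i v) _).trans (le_of_eq ?_)
          rw [add_assoc, add_assoc, ← EReal.coe_add, ← EReal.coe_add]
          congr 2
          simp only [inner_sub_left, inner_sub_right]
          ring
      _ = ∑ i, (conjugate (P.f i) (-(LinearMap.adjoint (P.A i) v)) +
          ((inner ℝ v (P.b i) : ℝ) : EReal))
          + ((∑ i, inner ℝ (v - y) (a i - P.b i) : ℝ) : EReal) := by
          rw [Finset.sum_add_distrib, coe_sum]
      _ ≤ _ := by
          refine (add_le_add_right (EReal.coe_le_coe_iff.2 hsum) _).trans ?_
          rw [EReal.coe_zero, add_zero]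
  · obtain ⟨i⟩ := ‹Nonempty ι›
    refine le_top.trans_eq (sum_eq_top (fun j _ => dualTerm_ne_bot hP v j)
      (Finset.mem_univ i) ?_).symm
    rw [indicatorFun, if_neg hv]
    exact EReal.add_top_of_ne_bot (add_ne_bot (conjugate_ne_bot (hP.proper i) _)
      (EReal.coe_ne_bot _))

end Problem
end DualConsensus

/-! ### The iteration as an instance of the abstract scheme -/

namespace DualConsensus.Problem

variable {ι : Type*} [Fintype ι] {E : ι → Type*} {F : Type*}
  [∀ i, NormedAddCommGroup (E i)] [∀ i, InnerProductSpace ℝ (E i)]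
  [NormedAddCommGroup F] [InnerProductSpace ℝ F]
  {P : Problem ι E F} {G : SimpleGraph ι} [DecidableRel G.Adj] {σ ρ : ℝ}
  {p s r : ℕ → ι → F} {x : ℕ → ∀ i, E i} {y z : ℕ → ι → F}

/-- The next multiplier `s (k + 2)` is `σ` times the residual of the projection defining `z (k +
1)`. -/
theorem IsRun.normal (hσ : 0 < σ) (hrun : P.IsRun G σ ρ p s r x y z) (k : ℕ) (i : ι) {v : F}
    (hv : v ∈ polarCone (P.K : Set F)) : inner ℝ (s (k + 2) i) (v - z (k + 1) i) ≤ 0 := by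
  have h := (hrun.z_succ k i).inner_le_zero (convex_polarCone _) hv
  have e : s (k + 2) i = σ • (y (k + 1) i + (1 / σ) • s (k + 1) i - z (k + 1) i) := by
    rw [hrun.s_succ (k + 1) i, smul_sub, smul_sub, smul_add, smul_smul,
      mul_one_div_cancel hσ.ne', one_smul]
    abel
  rw [e, real_inner_smul_left]
  exact mul_nonpos_of_nonneg_of_nonpos hσ.le h

/-- The optimality condition of the iteration. -/
theorem IsRun.b_sub_eq (hσ : 0 < σ) (hρ : 0 < ρ) (hrun : P.IsRun G σ ρ p s r x y z)
    (k : ℕ) (i : ι) :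
    P.b i - P.A i (x (k + 2) i) = -s (k + 3) i - p (k + 3) i
      - σ • (z (k + 2) i - z (k + 1) i)
      - ρ • ∑ j ∈ G.neighborFinset i, ((y (k + 2) i - y (k + 1) i)
        + (1 : ℝ) • (y (k + 2) j - y (k + 1) j)) := by
  have hc : σ + 2 * ρ * (G.degree i : ℝ) ≠ 0 := by positivity
  have hA : P.A i (x (k + 2) i) =
      (σ + 2 * ρ * (G.degree i : ℝ)) • y (k + 2) i - r (k + 2) i := by
    rw [hrun.y_succ (k + 1) i, smul_smul, mul_one_div_cancel hc, one_smul, add_sub_cancel_right]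
  -- The term `2ρ d_i y_i` splits into neighbor differences, absorbed into `p (k + 3)`, and neighbor
  -- sums, which form the proximal term.
  rw [hA, hrun.r_succ (k + 1) i, hrun.s_succ (k + 2) i, hrun.p_succ (k + 2) i]
  simp only [one_smul, Finset.sum_add_distrib, Finset.sum_sub_distrib, Finset.sum_const,
    G.card_neighborFinset_eq_degree, ← Nat.cast_smul_eq_nsmul ℝ]
  module

variable [FiniteDimensional ℝ F]

/-- Starting from `p 0 = 0`, every increment is `B^* B y`, so `p` stays in the range of `B^*`. The
accumulated edge values serve as the multiplier `D`. -/
theorem IsRun.p_eq (hρ : 0 < ρ) (hrun : P.IsRun G σ ρ p s r x y z) (k : ℕ) :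
    WithLp.toLp 2 (p k) = LinearMap.adjoint (edgeMap G ρ (-1))
      (∑ l ∈ Finset.range k, edgeMap G ρ (-1) (WithLp.toLp 2 (y l))) := by
  induction k with
  | zero =>
    ext i
    simp [hrun.p_zero i]
  | succ k ih =>
    rw [Finset.sum_range_succ, map_add, ← ih, adjoint_edgeMap_edgeMap G hρ.le (by norm_num)]
    ext i
    simp [hrun.p_succ k i, sub_eq_add_neg]

variable [∀ i, FiniteDimensional ℝ (E i)]

theorem IsRun.isNegSubgradient (hP : P.Assumptions) (hrun : P.IsRun G σ ρ p s r x y z)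
    (k : ℕ) (i : ι) : IsNegSubgradient (P.f i) (P.A i) (x (k + 1) i) (y (k + 1) i) := by
  rw [hrun.y_succ k i]
  exact isNegSubgradient_of_isMinOn (hP.convex i) (hP.proper i) (P.A i) _ _ (hrun.x_succ k i)

/-- The iterates of the decomposed dual consensus method converge to a dual solution. -/
theorem IsRun.exists_tendsto (hP : P.Assumptions)
    (hG : G.Connected) (hσ : 0 < σ) (hρ : 0 < ρ) (hrun : P.IsRun G σ ρ p s r x y z) :
    ∃ (y₀ : F) (s₀ w₀ : ι → F), y₀ ∈ polarCone (P.K : Set F) ∧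
      (∀ i, Tendsto (fun k => y (k + 1) i) atTop (𝓝 y₀)) ∧
      (∀ i, Tendsto (fun k => z (k + 1) i) atTop (𝓝 y₀)) ∧
      (∀ i, Tendsto (fun k => P.b i - P.A i (x (k + 1) i)) atTop (𝓝 (w₀ i))) ∧
      ∑ i, w₀ i = -∑ i, s₀ i ∧
      ∀ i, ∀ v ∈ polarCone (P.K : Set F), inner ℝ (s₀ i) (v - y₀) ≤ 0 := by
  have : Nonempty ι := hG.nonempty
  obtain ⟨xs, ys, hxs, hys, hsub, hcomp⟩ := hP.exists_kkt
  have hN := fun k i v hv => hrun.normal hσ k i (v := v) hv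
  -- The shift drops the arbitrary initial values; `S` and `D` run one index ahead, since `s (n +
  -- 2)` is the vector normal at `z (n + 1)`.
  obtain ⟨y₀, s₀, d₀, hy₀, tY, tZ, tS, tW⟩ := exists_tendsto_of_monotone
    (edgeMap G ρ (-1)) (edgeMap G ρ 1) hσ
    (Y := fun n => WithLp.toLp 2 (y (n + 1))) (Z := fun n => WithLp.toLp 2 (z (n + 1)))
    (S := fun n => WithLp.toLp 2 (s (n + 2)))
    (W := fun n => WithLp.toLp 2 fun i => P.b i - P.A i (x (n + 1) i))
    (D := fun n => ∑ l ∈ Finset.range (n + 2), edgeMap G ρ (-1) (WithLp.toLp 2 (y l)))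
    (fun n => Finset.sum_range_succ _ _)
    (fun n => by ext i; simp [hrun.s_succ (n + 2) i])
    (fun n => by
      rw [← hrun.p_eq hρ, adjoint_edgeMap_edgeMap G hρ.le (by norm_num)]
      ext i
      exact hrun.b_sub_eq hσ hρ n i)
    (fun m n => by
      rw [PiLp.inner_apply]
      refine Finset.sum_nonneg fun i _ => ?_
      have h := (hrun.isNegSubgradient hP m i).monotone (hP.proper i)
        (hrun.isNegSubgradient hP n i)
      have e : ∀ a b : F, P.b i - a - (P.b i - b) = -(a - b) := fun a b => by abel
      simp only [PiLp.sub_apply]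
      rw [e, inner_neg_left, real_inner_comm]
      exact neg_nonneg.2 h)
    (fun m n => by
      rw [PiLp.inner_apply]
      refine Finset.sum_nonneg fun i _ => ?_
      have h1 := hN m i _ (hrun.z_succ n i).1
      have h2 := hN n i _ (hrun.z_succ m i).1
      simp only [PiLp.sub_apply]
      rw [inner_sub_left, ← neg_sub (z (n + 1) i) (z (m + 1) i), inner_neg_right,
        inner_neg_right]
      rw [← neg_sub (z (n + 1) i) (z (m + 1) i), inner_neg_right] at h2
      linarith)
    (by
      -- The KKT slack `S` is shared equally among the agents as `s`. What remains of `-W` then sums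
      -- to zero and is therefore some `B^* d`.
      set S := ∑ i, (P.A i (xs i) - P.b i) with hS
      set c : ℝ := (Fintype.card ι : ℝ)⁻¹ with hcdef
      obtain ⟨d, hd⟩ := exists_adjoint_edgeMap_eq hG hρ
        (q := WithLp.toLp 2 fun i => -(P.b i - P.A i (xs i)) - c • S) (by
          have hcard : (Fintype.card ι : ℝ) ≠ 0 := Nat.cast_ne_zero.2 Fintype.card_ne_zero
          simp only [neg_sub, Finset.sum_sub_distrib (f := fun i => P.A i (xs i) - P.b i),
            Finset.sum_const, Finset.card_univ, ← Nat.cast_smul_eq_nsmul ℝ, smul_smul]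
          rw [← hS, hcdef, mul_inv_cancel₀ hcard, one_smul, sub_self])
      refine ⟨WithLp.toLp 2 fun _ => ys, WithLp.toLp 2 fun _ => c • S, d,
        edgeMap_neg_one_const G ρ ys, fun n => ?_, fun n => ?_⟩
      · rw [hd, PiLp.inner_apply]
        refine Finset.sum_nonneg fun i _ => ?_
        have h := (hrun.isNegSubgradient hP n i).monotone (hP.proper i) (hsub i)
        have e : ∀ a b : F, P.b i - a - (-(c • S) - (-(P.b i - b) - c • S)) = -(a - b) :=
          fun a b => by abel
        simp only [PiLp.sub_apply, PiLp.neg_apply]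
        rw [e, inner_neg_left, real_inner_comm]
        exact neg_nonneg.2 h
      · rw [PiLp.inner_apply]
        refine Finset.sum_nonneg fun i _ => ?_
        have h1 := hN n i _ hys
        have h2 : inner ℝ S (z (n + 1) i) ≤ 0 := (hrun.z_succ n i).1 _ hxs
        have h3 : c * inner ℝ S (z (n + 1) i) ≤ 0 :=
          mul_nonpos_of_nonneg_of_nonpos (by positivity) h2
        simp only [PiLp.sub_apply]
        rw [inner_sub_left, real_inner_smul_left, inner_sub_right S, hcomp]
        rw [← neg_sub, inner_neg_right] at h1
        linarith)
  obtain ⟨i₀⟩ := hG.nonempty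
  have hconst : ∀ i, y₀ i = y₀ i₀ := fun i => eq_of_edgeMap_eq_zero hG hρ hy₀ i i₀
  have comp : ∀ {u : ℕ → PiLp 2 fun _ : ι => F} {l : PiLp 2 fun _ : ι => F},
      Tendsto u atTop (𝓝 l) → ∀ i, Tendsto (fun n => u n i) atTop (𝓝 (l i)) :=
    fun {_ l} h i => ((PiLp.continuous_apply 2 _ i).tendsto l).comp h
  have tz : ∀ i, Tendsto (fun k => z (k + 1) i) atTop (𝓝 (y₀ i₀)) := fun i =>
    hconst i ▸ comp tZ i
  refine ⟨y₀ i₀, fun i => s₀ i, fun i => -s₀ i - LinearMap.adjoint (edgeMap G ρ (-1)) d₀ i,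
    (isClosed_polarCone _).mem_of_tendsto (tz i₀)
      (Eventually.of_forall fun n => (hrun.z_succ n i₀).1),
    fun i => hconst i ▸ comp tY i, tz, fun i => comp tW i, ?_, fun i v hv => ?_⟩
  · rw [Finset.sum_sub_distrib, sum_adjoint_edgeMap, sub_zero, Finset.sum_neg_distrib]
  · exact le_of_tendsto ((comp tS i).inner ((tz i).const_sub v))
      (Eventually.of_forall fun n => hN n i v hv)

end DualConsensus.Problem

/-! ### Convergence to dual and primal solutions -/

theorem proposition2 {ι : Type*} [Fintype ι] {E : ι → Type*} {F : Type*}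
    [∀ i, NormedAddCommGroup (E i)] [∀ i, InnerProductSpace ℝ (E i)]
    [∀ i, FiniteDimensional ℝ (E i)]
    [NormedAddCommGroup F] [InnerProductSpace ℝ F] [FiniteDimensional ℝ F]
    (P : DualConsensus.Problem ι E F) (hP : P.Assumptions)
    (G : SimpleGraph ι) [DecidableRel G.Adj] (hG : G.Connected)
    (σ ρ : ℝ) (hσ : 0 < σ) (hρ : 0 < ρ)
    (p s r : ℕ → ι → F) (x : ℕ → ∀ i, E i) (y z : ℕ → ι → F)
    (hrun : P.IsRun G σ ρ p s r x y z) :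
    (∃ ystar : F, P.IsDualMaximizer ystar ∧
      ∀ i, Tendsto (fun k => y k i) atTop (𝓝 ystar) ∧
        Tendsto (fun k => z k i) atTop (𝓝 ystar)) ∧
    ∀ xbar : ∀ i, E i, MapClusterPt xbar atTop x → P.IsPrimalMinimizer xbar := by
  have : Nonempty ι := hG.nonempty
  obtain ⟨y₀, s₀, w₀, hy₀, tY, tZ, tW, hws, hs⟩ := hrun.exists_tendsto hP hG hσ hρ
  have hsum : ∀ v ∈ DualConsensus.polarCone (P.K : Set F),
      inner ℝ (∑ i, s₀ i) (v - y₀) ≤ 0 := fun v hv => by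
    rw [sum_inner]
    exact Finset.sum_nonpos fun i _ => hs i v hv
  have tA : ∀ i, Tendsto (fun k => P.A i (x (k + 1) i)) atTop (𝓝 (P.b i - w₀ i)) := fun i => by
    simpa using (tW i).const_sub (P.b i)
  refine ⟨⟨y₀, DualConsensus.Problem.isDualMaximizer_of_le hP hy₀ (a := fun i => P.b i - w₀ i)
    (fun i v => DualConsensus.conjugate_le_of_tendsto (hP.proper i)
      (fun n => hrun.isNegSubgradient hP n i) (tY i) (tA i) v) ?_,
    fun i => ⟨(tendsto_add_atTop_iff_nat 1).1 (tY i), (tendsto_add_atTop_iff_nat 1).1 (tZ i)⟩⟩,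
    fun xbar hx => ?_⟩
  · intro v hv
    simpa [sub_sub_cancel_left, hws] using hsum v hv
  · obtain ⟨ψ, hψ, hlim⟩ := hx.tendsto_subseq
    -- The value `x 0` obeys no optimality condition, so the subsequence is rewritten with indices
    -- of the form `m + 1`.
    have hψ1 : ∀ n, ψ (n + 1) - 1 + 1 = ψ (n + 1) := fun n =>
      Nat.sub_add_cancel (Nat.one_le_of_lt (hψ n.lt_succ_self))
    have tm : Tendsto (fun n => ψ (n + 1) - 1) atTop atTop :=
      (tendsto_sub_atTop_nat 1).comp (hψ.tendsto_atTop.comp (tendsto_add_atTop_nat 1))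
    have tx : ∀ i, Tendsto (fun n => x (ψ (n + 1) - 1 + 1) i) atTop (𝓝 (xbar i)) := fun i => by
      simp only [hψ1]
      exact (tendsto_pi_nhds.1 hlim i).comp (tendsto_add_atTop_nat 1)
    have cA : ∀ i, Continuous (P.A i) := fun i => (P.A i).continuous_of_finiteDimensional
    -- All cluster points have the same images under the `A i`, so feasibility and complementarity
    -- reduce to properties of `∑ i, s₀ i`.
    have hA : ∀ i, P.A i (xbar i) = P.b i - w₀ i := fun i =>
      tendsto_nhds_unique (((cA i).tendsto _).comp (tx i)) ((tA i).comp tm)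
    have hAs : ∑ i, (P.A i (xbar i) - P.b i) = ∑ i, s₀ i := by
      simp [hA, hws]
    refine DualConsensus.Problem.isPrimalMinimizer_of_kkt ?_ hy₀ (fun i => ?_) ?_
    · change ∑ i, (P.A i (xbar i) - P.b i) ∈ P.K
      rw [hAs]
      exact DualConsensus.mem_of_normal_polarCone P.K hP.cone_nonempty hP.cone_closed hy₀ hsum
    · exact .of_tendsto (hP.proper i) (hP.closed i) (cA i)
        (fun n => hrun.isNegSubgradient hP _ i) (tx i) ((tY i).comp tm)
    · rw [hAs]
      exact DualConsensus.inner_eq_zero_of_normal_polarCone hy₀ hsum
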